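/- Let $n\ge 0$, let $(\Xi_k,\rho_k)$, $k=1,\dots,n$, be metric spaces, let $\Xi=\Xi_1\times\cdots\times\Xi_n$, and let $\rho$ be a metric on $\Xi$ such that $(\Xi,\rho)$ is complete and separable. Assume that, for some $q\in[1,\infty]$, $\rho$ is strongly equivalent to the product metric $d_q=(\sum_{k=1}^n\rho_k^q)^{1/q}$ ($d_\infty=\max_k\rho_k$), i.e. $c\,d_q\le\rho\le C\,d_q$ for some constants $c,C>0$. Let $p\ge 1$, let $Q$ be a Borel probability measure on $\Xi$ with finite $p$-th moment, i.e. $\int_\Xi\rho(\zeta,\xi)^p\,dQ(\xi)<\infty$ for some $\zeta\in\Xi$, and let $\varepsilon=(\varepsilon_1,\dots,\varepsilon_n)$ with $\varepsilon_k>0$ for all $k$. Let $\mathcal T_p(Q,\varepsilon)$ be the multi-transport hyperrectangle, i.e. the set of second marginals of all Borel probability measures $\pi$ on $\Xi\times\Xi$ whose first marginal is $Q$ and which satisfy $$\int_{\Xi\times\Xi}\rho_k(\zeta_k,\xi_k)^p\,d\pi(\zeta,\xi)\le\varepsilon_k^p\qquad\text{for all }k=1,\dots,n.$$ Let $h:\Xi\to\mathbb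 R$ be Borel measurable and $Q$-integrable. For a probability measure $P$ on $\Xi$ let $\mathbb E_P[h]=\int h^+\,dP-\int h^-\,dP\in[-\infty,\infty]$, with the convention $\infty-\infty=-\infty$. Then the worst-case expectation $$\sup_{P\in\mathcal T_p(Q,\varepsilon)}\mathbb E_P[h]$$ is finite (i.e. different from $-\infty$ and $+\infty$) if and only if there are $C>0$ and $\zeta\in\Xi$ such that $$h(\xi)\le C\,(1+\rho(\zeta,\xi)^p)\qquad\text{for all }\xi\in\Xi.$$ -/

import Mathlib

open MeasureTheory
open scoped ENNReal

/-- The product set `Ξ₁ × ⋯ × Ξₙ`. It is a fresh type, and not `∀ k, X k`, so that it comes with no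
preset metric: the metric `ρ` on it is an arbitrary one, given separately. -/
@[ext] structure ProductSpace {n : ℕ} (X : Fin n → Type*) where
  /-- the components of a point -/
  coord : ∀ k, X k

/-- The metric `ρ` on `Ξ = Ξ₁ × ⋯ × Ξₙ` is (strongly) equivalent to the product metric
`(∑ₖ ρₖ ^ q) ^ (1 / q)` (the maximum of the `ρₖ` if `q = ∞`) for some `q ∈ [1, ∞]`:
each of the two is bounded by a constant multiple of the other. -/
def EquivalentToProductMetric {n : ℕ} (X : Fin n → Type*) [∀ k, MetricSpace (X k)]
    [MetricSpace (ProductSpace X)] : Prop :=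
  ∃ (q : ℝ≥0∞) (_ : Fact (1 ≤ q)) (c C : ℝ), 0 < c ∧ 0 < C ∧
    ∀ ζ ξ : ProductSpace X,
      c * dist (WithLp.toLp q ζ.coord) (WithLp.toLp q ξ.coord) ≤ dist ζ ξ ∧
      dist ζ ξ ≤ C * dist (WithLp.toLp q ζ.coord) (WithLp.toLp q ξ.coord)

/-- `Q` has a finite `p`-th moment. -/
def HasFiniteMoment {Ξ : Type*} [MetricSpace Ξ] [MeasurableSpace Ξ] (p : ℝ) (Q : Measure Ξ) :
    Prop :=
  ∃ ζ : Ξ, ∫⁻ ξ, ENNReal.ofReal (dist ζ ξ ^ p) ∂Q < ∞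

/-- The class of real functions `h` with `h ξ ≤ C (1 + ρ(ζ, ξ) ^ r)` for all `ξ`, for some `C > 0`
and some point `ζ`. -/
def GrowthUp (Ξ : Type*) [MetricSpace Ξ] (r : ℝ) : Set (Ξ → ℝ) :=
  {h | ∃ C : ℝ, 0 < C ∧ ∃ ζ : Ξ, ∀ ξ : Ξ, h ξ ≤ C * (1 + dist ζ ξ ^ r)}

/-- The multi-transport hyperrectangle `𝒯_p(Q, ε)`: second marginals of the probability measures `π`
on `Ξ × Ξ` with first marginal `Q` and `∫ ρₖ(ζₖ, ξₖ) ^ p dπ(ζ, ξ) ≤ εₖ ^ p` for each `k`. -/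
def MTH {n : ℕ} {X : Fin n → Type*} [∀ k, MetricSpace (X k)] [MeasurableSpace (ProductSpace X)]
    (p : ℝ) (Q : Measure (ProductSpace X)) (ε : Fin n → ℝ) : Set (Measure (ProductSpace X)) :=
  {P | ∃ π : Measure (ProductSpace X × ProductSpace X), IsProbabilityMeasure π ∧
    π.map Prod.fst = Q ∧ π.map Prod.snd = P ∧
    ∀ k, ∫⁻ z, ENNReal.ofReal (dist (z.1.coord k) (z.2.coord k) ^ p) ∂π
      ≤ ENNReal.ofReal (ε k ^ p)}

/-- The expectation `E_P[h] = E_P[h⁺] - E_P[h⁻]` as an extended real number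
(in `EReal`, `∞ - ∞ = -∞`). -/
noncomputable def extExpectation {Ξ : Type*} [MeasurableSpace Ξ] (P : Measure Ξ) (h : Ξ → ℝ) :
    EReal :=
  ((∫⁻ ξ, ENNReal.ofReal (h ξ) ∂P : ℝ≥0∞) : EReal) -
    ((∫⁻ ξ, ENNReal.ofReal (-h ξ) ∂P : ℝ≥0∞) : EReal)

/-- The worst-case expectation `sup_{P ∈ 𝒯_p(Q, ε)} E_P[h]`. -/
noncomputable def worstCaseExpectation {n : ℕ} {X : Fin n → Type*} [∀ k, MetricSpace (X k)]
    [MeasurableSpace (ProductSpace X)] (p : ℝ) (Q : Measure (ProductSpace X)) (ε : Fin n → ℝ)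
    (h : ProductSpace X → ℝ) : EReal :=
  ⨆ P ∈ MTH p Q ε, extExpectation P h

/-! Growth of order `p` is what a transport budget of order `p` can pay for. If `h` grows at most
like `ρ ^ p`, the budgets on the components add up to a bound on the `ρ`-transport cost, so the
`p`-th moments over the hyperrectangle are uniformly bounded (`exists_forall_mem_MTH_lintegral_le`),
and so is the expectation of `h⁺`; `Q` itself keeps the supremum above `-∞`. Conversely, sending a
share `t` of `Q` to a point `η` costs at most `t` times a constant multiple of `1 + ρ(ζ, η) ^ p` in
each component, so a share `δ / (1 + ρ(ζ, η) ^ p)` is affordable with one `δ` for all `η`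
(`exists_forall_mix_dirac_mem_MTH`). If growth fails, `h η` times this share is unbounded, while the
negative part costs no more than under `Q`. -/

/-- A metric equivalent to a product metric dominates the metrics of the components. -/
lemma EquivalentToProductMetric.exists_dist_coord_le {n : ℕ} {X : Fin n → Type*}
    [∀ k, MetricSpace (X k)] [MetricSpace (ProductSpace X)] (hρ : EquivalentToProductMetric X) :
    ∃ a : ℝ, 0 ≤ a ∧ ∀ (k : Fin n) (ζ ξ : ProductSpace X),
      dist (ζ.coord k) (ξ.coord k) ≤ a * dist ζ ξ := by
  obtain ⟨q, hq, c, C, hc, -, hd⟩ := hρ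
  refine ⟨c⁻¹, by positivity, fun k ζ ξ ↦ ?_⟩
  have h1 := (PiLp.lipschitzWith_ofLp q X).dist_le_mul (WithLp.toLp q ζ.coord)
    (WithLp.toLp q ξ.coord)
  simp only [NNReal.coe_one, one_mul] at h1
  rw [inv_mul_eq_div, le_div_iff₀ hc, mul_comm]
  exact (mul_le_mul_of_nonneg_left ((dist_le_pi_dist ζ.coord ξ.coord k).trans h1) hc.le).trans
    (hd ζ ξ).1

/-- The `p`-th power of a metric equivalent to a product metric is dominated by the sum of the
`p`-th powers of the metrics of the components. -/
lemma EquivalentToProductMetric.exists_dist_rpow_le {n : ℕ} {X : Fin n → Type*}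
    [∀ k, MetricSpace (X k)] [MetricSpace (ProductSpace X)] (hρ : EquivalentToProductMetric X)
    {p : ℝ} (hp : 0 < p) :
    ∃ b : ℝ, 0 ≤ b ∧ ∀ ζ ξ : ProductSpace X,
      dist ζ ξ ^ p ≤ b * ∑ k, dist (ζ.coord k) (ξ.coord k) ^ p := by
  obtain ⟨q, hq, c, C, -, hC, hd⟩ := hρ
  obtain ⟨K, hK⟩ : ∃ K : NNReal, AntilipschitzWith K (@WithLp.ofLp q (∀ k, X k)) :=
    ⟨_, PiLp.antilipschitzWith_ofLp q X⟩
  refine ⟨(C * K) ^ p, by positivity, fun ζ ξ ↦ ?_⟩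
  set S := ∑ k, dist (ζ.coord k) (ξ.coord k) ^ p with hS
  have hS0 : 0 ≤ S := Finset.sum_nonneg fun k _ ↦ by positivity
  have h1 := hK.le_mul_dist (WithLp.toLp q ζ.coord) (WithLp.toLp q ξ.coord)
  -- Comparison through the sup metric makes the exponent `q` irrelevant.
  have h2 : dist ζ.coord ξ.coord ≤ S ^ p⁻¹ := by
    refine (dist_pi_le_iff (by positivity)).2 fun k ↦ ?_
    rw [Real.le_rpow_inv_iff_of_pos dist_nonneg hS0 hp]
    exact Finset.single_le_sum (f := fun k ↦ dist (ζ.coord k) (ξ.coord k) ^ p)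
      (fun k _ ↦ by positivity) (Finset.mem_univ k)
  have h3 : dist ζ ξ ≤ C * K * S ^ p⁻¹ :=
    calc dist ζ ξ ≤ C * (K * dist ζ.coord ξ.coord) :=
          (hd ζ ξ).2.trans (mul_le_mul_of_nonneg_left h1 hC.le)
      _ ≤ C * (K * S ^ p⁻¹) := by gcongr
      _ = C * K * S ^ p⁻¹ := by ring
  calc dist ζ ξ ^ p ≤ (C * K * S ^ p⁻¹) ^ p := by gcongr
    _ = (C * K) ^ p * S := by
      rw [Real.mul_rpow (by positivity) (by positivity), Real.rpow_inv_rpow hS0 hp.ne']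

/-- Triangle inequality followed by convexity of `x ^ p`. -/
lemma dist_rpow_le_two_rpow_mul {Ξ : Type*} [PseudoMetricSpace Ξ] {p : ℝ} (hp : 1 ≤ p)
    (x y z : Ξ) : dist x z ^ p ≤ 2 ^ (p - 1) * (dist x y ^ p + dist y z ^ p) :=
  (Real.rpow_le_rpow dist_nonneg (dist_triangle x y z) (by linarith)).trans
    (mod_cast NNReal.rpow_add_le_mul_rpow_add_rpow (nndist x y) (nndist y z) hp)

/-- Finiteness of the `p`-th moment does not depend on the base point. -/
lemma HasFiniteMoment.lintegral_lt_top {Ξ : Type*} [MetricSpace Ξ] [MeasurableSpace Ξ]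
    [OpensMeasurableSpace Ξ] {p : ℝ} {Q : Measure Ξ} [IsFiniteMeasure Q] (hp : 1 ≤ p)
    (hQ : HasFiniteMoment p Q) (ζ : Ξ) :
    ∫⁻ ξ, ENNReal.ofReal (dist ζ ξ ^ p) ∂Q < ∞ := by
  obtain ⟨ζ₀, h₀⟩ := hQ
  calc ∫⁻ ξ, ENNReal.ofReal (dist ζ ξ ^ p) ∂Q
      ≤ ∫⁻ ξ, ENNReal.ofReal (2 ^ (p - 1)) *
          (ENNReal.ofReal (dist ζ ζ₀ ^ p) + ENNReal.ofReal (dist ζ₀ ξ ^ p)) ∂Q := by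
        refine lintegral_mono fun ξ ↦ ?_
        rw [← ENNReal.ofReal_add (by positivity) (by positivity),
          ← ENNReal.ofReal_mul (by positivity)]
        exact ENNReal.ofReal_le_ofReal (dist_rpow_le_two_rpow_mul hp ζ ζ₀ ξ)
    _ < ∞ := by
        rw [lintegral_const_mul' _ _ ENNReal.ofReal_ne_top, lintegral_add_left measurable_const,
          lintegral_const]
        exact ENNReal.mul_lt_top ENNReal.ofReal_lt_top (ENNReal.add_lt_top.2
          ⟨ENNReal.mul_lt_top ENNReal.ofReal_lt_top (measure_lt_top _ _), h₀⟩)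

/-- The `p`-th moments of the members of a multi-transport hyperrectangle around a measure with
finite `p`-th moment are uniformly bounded. -/
lemma exists_forall_mem_MTH_lintegral_le {n : ℕ} {X : Fin n → Type*} [∀ k, MetricSpace (X k)]
    [MetricSpace (ProductSpace X)] [SecondCountableTopology (ProductSpace X)]
    [MeasurableSpace (ProductSpace X)] [BorelSpace (ProductSpace X)]
    (hρ : EquivalentToProductMetric X) {p : ℝ} (hp : 1 ≤ p)
    {Q : Measure (ProductSpace X)} [IsProbabilityMeasure Q] (hQ : HasFiniteMoment p Q)
    (ε : Fin n → ℝ) (ζ : ProductSpace X) :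
    ∃ M : ℝ≥0∞, M ≠ ∞ ∧ ∀ P ∈ MTH p Q ε, ∫⁻ ξ, ENNReal.ofReal (dist ζ ξ ^ p) ∂P ≤ M := by
  obtain ⟨a, -, ha⟩ := hρ.exists_dist_coord_le
  obtain ⟨b, hb0, hb⟩ := hρ.exists_dist_rpow_le (p := p) (by linarith)
  have hcoord : ∀ k, Measurable fun z : ProductSpace X × ProductSpace X ↦
      ENNReal.ofReal (dist (z.1.coord k) (z.2.coord k) ^ p) := by
    intro k
    -- Measurability of the cost is not automatic: the Borel structure comes from `ρ`, so the
    -- projections must be shown continuous for `ρ`.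
    have hc : Continuous fun ξ : ProductSpace X ↦ ξ.coord k :=
      (LipschitzWith.of_dist_le_mul (K := a.toNNReal) fun ζ ξ ↦
        (ha k ζ ξ).trans (mul_le_mul_of_nonneg_right (Real.le_coe_toNNReal a)
          dist_nonneg)).continuous
    have : Continuous fun z : ProductSpace X × ProductSpace X ↦
      dist (z.1.coord k) (z.2.coord k) := (hc.comp continuous_fst).dist (hc.comp continuous_snd)
    exact (this.measurable.pow_const p).ennreal_ofReal
  have hdist : Measurable fun ξ : ProductSpace X ↦ ENNReal.ofReal (dist ζ ξ ^ p) :=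
    ((measurable_const.dist measurable_id).pow_const p).ennreal_ofReal
  refine ⟨ENNReal.ofReal (2 ^ (p - 1)) * (∫⁻ ξ, ENNReal.ofReal (dist ζ ξ ^ p) ∂Q +
    ENNReal.ofReal b * ∑ k, ENNReal.ofReal (ε k ^ p)), ?_, ?_⟩
  · exact ENNReal.mul_ne_top ENNReal.ofReal_ne_top (ENNReal.add_ne_top.2
      ⟨(hQ.lintegral_lt_top hp ζ).ne, ENNReal.mul_ne_top ENNReal.ofReal_ne_top
        (ENNReal.sum_ne_top.2 fun _ _ ↦ ENNReal.ofReal_ne_top)⟩)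
  · rintro P ⟨π, -, rfl, rfl, hπ⟩
    rw [lintegral_map hdist measurable_snd, lintegral_map hdist measurable_fst]
    calc ∫⁻ z, ENNReal.ofReal (dist ζ z.2 ^ p) ∂π
        ≤ ∫⁻ z, ENNReal.ofReal (2 ^ (p - 1)) * (ENNReal.ofReal (dist ζ z.1 ^ p) +
            ENNReal.ofReal b *
              ∑ k, ENNReal.ofReal (dist (z.1.coord k) (z.2.coord k) ^ p)) ∂π := by
          refine lintegral_mono fun z ↦ ?_
          rw [← ENNReal.ofReal_sum_of_nonneg fun k _ ↦ by positivity,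
            ← ENNReal.ofReal_mul hb0,
            ← ENNReal.ofReal_add (by positivity)
              (mul_nonneg hb0 (Finset.sum_nonneg fun k _ ↦ by positivity)),
            ← ENNReal.ofReal_mul (by positivity)]
          refine ENNReal.ofReal_le_ofReal ((dist_rpow_le_two_rpow_mul hp ζ z.1 z.2).trans ?_)
          gcongr
          exact hb _ _
      _ = ENNReal.ofReal (2 ^ (p - 1)) * (∫⁻ z, ENNReal.ofReal (dist ζ z.1 ^ p) ∂π +
            ENNReal.ofReal b *
              ∑ k, ∫⁻ z, ENNReal.ofReal (dist (z.1.coord k) (z.2.coord k) ^ p) ∂π) := by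
          rw [lintegral_const_mul' _ _ ENNReal.ofReal_ne_top,
            lintegral_add_left (f := fun z : ProductSpace X × ProductSpace X ↦
              ENNReal.ofReal (dist ζ z.1 ^ p)) (hdist.comp measurable_fst),
            lintegral_const_mul' _ _ ENNReal.ofReal_ne_top,
            lintegral_finsetSum _ fun k _ ↦ hcoord k]
      _ ≤ _ := by
          gcongr with k
          exact hπ k

/-- A measure belongs to every multi-transport hyperrectangle around it. -/
lemma self_mem_MTH {n : ℕ} {X : Fin n → Type*} [∀ k, MetricSpace (X k)]
    [MeasurableSpace (ProductSpace X)] {p : ℝ} (hp : 0 < p)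
    (Q : Measure (ProductSpace X)) [IsProbabilityMeasure Q] (ε : Fin n → ℝ) : Q ∈ MTH p Q ε := by
  have hd : Measurable fun ξ : ProductSpace X ↦ (ξ, ξ) := measurable_id.prodMk measurable_id
  refine ⟨Q.map fun ξ ↦ (ξ, ξ), Measure.isProbabilityMeasure_map hd.aemeasurable, ?_, ?_,
    fun k ↦ ?_⟩
  · rw [Measure.map_map measurable_fst hd]; exact Measure.map_id
  · rw [Measure.map_map measurable_snd hd]; exact Measure.map_id
  -- This inequality needs no measurability of the cost, and here none is available.
  · refine (lintegral_map_le _ _).trans ?_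
    simp [Real.zero_rpow hp.ne']

/-- Moving a small enough share `t` of the mass of `Q` to one point stays within the
multi-transport hyperrectangle. -/
lemma mix_dirac_mem_MTH {n : ℕ} {X : Fin n → Type*} [∀ k, MetricSpace (X k)]
    [MeasurableSpace (ProductSpace X)] {p : ℝ} (hp : 0 < p)
    (Q : Measure (ProductSpace X)) [IsProbabilityMeasure Q] (ε : Fin n → ℝ)
    (η : ProductSpace X) {t : ℝ≥0∞} (ht : t ≤ 1)
    (htε : ∀ k, t * ∫⁻ ζ, ENNReal.ofReal (dist (ζ.coord k) (η.coord k) ^ p) ∂Q ≤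
      ENNReal.ofReal (ε k ^ p)) :
    (1 - t) • Q + t • Measure.dirac η ∈ MTH p Q ε := by
  have hd : Measurable fun ξ : ProductSpace X ↦ (ξ, ξ) := measurable_id.prodMk measurable_id
  have hη : Measurable fun ξ : ProductSpace X ↦ (ξ, η) := measurable_id.prodMk measurable_const
  have hfst : ((1 - t) • Q.map (fun ξ ↦ (ξ, ξ)) + t • Q.map (fun ξ ↦ (ξ, η))).map Prod.fst = Q := by
    rw [Measure.map_add _ _ measurable_fst, Measure.map_smul, Measure.map_smul,
      Measure.map_map measurable_fst hd, Measure.map_map measurable_fst hη]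
    change (1 - t) • Q.map id + t • Q.map id = Q
    rw [Measure.map_id, ← add_smul, tsub_add_cancel_of_le ht, one_smul]
  -- The coupling leaves a share `1 - t` in place, at no cost, and sends the rest to `η`.
  refine ⟨(1 - t) • Q.map (fun ξ ↦ (ξ, ξ)) + t • Q.map (fun ξ ↦ (ξ, η)), ?_, hfst, ?_, fun k ↦ ?_⟩
  · refine ⟨?_⟩
    rw [← Set.preimage_univ (f := Prod.fst), ← Measure.map_apply measurable_fst .univ, hfst,
      measure_univ]
  · rw [Measure.map_add _ _ measurable_snd, Measure.map_smul, Measure.map_smul,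
      Measure.map_map measurable_snd hd, Measure.map_map measurable_snd hη]
    change (1 - t) • Q.map id + t • Q.map (fun _ ↦ η) = _
    rw [Measure.map_id, Measure.map_const, measure_univ, one_smul]
  · rw [lintegral_add_measure, lintegral_smul_measure, lintegral_smul_measure]
    have h1 : ∫⁻ z, ENNReal.ofReal (dist (z.1.coord k) (z.2.coord k) ^ p)
        ∂(Q.map fun ξ ↦ (ξ, ξ)) = 0 := by
      refine le_antisymm ((lintegral_map_le _ _).trans ?_) zero_le
      simp [Real.zero_rpow hp.ne']
    rw [h1, smul_zero, zero_add, smul_eq_mul]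
    exact (mul_le_mul_right (lintegral_map_le _ _) t).trans (htε k)

/-- Around a measure with finite `p`-th moment, mass of the order `1 / (1 + ρ(ζ, η) ^ p)` can be
moved to any point `η`. -/
lemma exists_forall_mix_dirac_mem_MTH {n : ℕ} {X : Fin n → Type*} [∀ k, MetricSpace (X k)]
    [MetricSpace (ProductSpace X)]
    [MeasurableSpace (ProductSpace X)] [OpensMeasurableSpace (ProductSpace X)]
    (hρ : EquivalentToProductMetric X) {p : ℝ} (hp : 1 ≤ p)
    {Q : Measure (ProductSpace X)} [IsProbabilityMeasure Q] (hQ : HasFiniteMoment p Q)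
    {ε : Fin n → ℝ} (hε : ∀ k, 0 < ε k) (ζ : ProductSpace X) :
    ∃ δ : ℝ, 0 < δ ∧ ∀ η : ProductSpace X,
      (1 - ENNReal.ofReal (δ / (1 + dist ζ η ^ p))) • Q +
        ENNReal.ofReal (δ / (1 + dist ζ η ^ p)) • Measure.dirac η ∈ MTH p Q ε := by
  obtain ⟨a, ha0, ha⟩ := hρ.exists_dist_coord_le
  have hM := hQ.lintegral_lt_top hp ζ
  set M := (∫⁻ ξ, ENNReal.ofReal (dist ζ ξ ^ p) ∂Q).toReal with hMdef
  have hM0 : 0 ≤ M := ENNReal.toReal_nonneg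
  set A := a ^ p * (2 ^ (p - 1) * (M + 1)) with hA
  have hA0 : 0 ≤ A := by positivity
  have hcost : ∀ k η, ∫⁻ ξ : ProductSpace X, ENNReal.ofReal (dist (ξ.coord k) (η.coord k) ^ p) ∂Q ≤
      ENNReal.ofReal (A * (1 + dist ζ η ^ p)) := by
    intro k η
    calc ∫⁻ ξ : ProductSpace X, ENNReal.ofReal (dist (ξ.coord k) (η.coord k) ^ p) ∂Q
        ≤ ∫⁻ ξ : ProductSpace X, ENNReal.ofReal (a ^ p * 2 ^ (p - 1)) *
            (ENNReal.ofReal (dist ζ η ^ p) + ENNReal.ofReal (dist ζ ξ ^ p)) ∂Q := by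
          refine lintegral_mono fun ξ ↦ ?_
          rw [← ENNReal.ofReal_add (by positivity) (by positivity),
            ← ENNReal.ofReal_mul (by positivity)]
          refine ENNReal.ofReal_le_ofReal ?_
          calc dist (ξ.coord k) (η.coord k) ^ p ≤ (a * dist ξ η) ^ p := by
                gcongr
                exact ha k ξ η
            _ = a ^ p * dist ξ η ^ p := Real.mul_rpow ha0 dist_nonneg
            _ ≤ a ^ p * (2 ^ (p - 1) * (dist ξ ζ ^ p + dist ζ η ^ p)) := by
                gcongr
                exact dist_rpow_le_two_rpow_mul hp ξ ζ η
            _ = _ := by rw [dist_comm ξ ζ]; ring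
      _ = ENNReal.ofReal (a ^ p * 2 ^ (p - 1)) *
            (ENNReal.ofReal (dist ζ η ^ p) + ENNReal.ofReal M) := by
          rw [lintegral_const_mul' _ _ ENNReal.ofReal_ne_top, lintegral_add_left measurable_const,
            lintegral_const, measure_univ, mul_one, hMdef, ENNReal.ofReal_toReal hM.ne]
      _ ≤ _ := by
          rw [← ENNReal.ofReal_add (by positivity) hM0, ← ENNReal.ofReal_mul (by positivity)]
          refine ENNReal.ofReal_le_ofReal ?_
          rw [hA, ← mul_assoc (a ^ p), mul_assoc _ (M + 1)]
          refine mul_le_mul_of_nonneg_left ?_ (by positivity)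
          have : 0 ≤ M * dist ζ η ^ p := by positivity
          linarith
  -- There are finitely many budgets, all positive; `δ ≤ 1` keeps the share at most `1`.
  obtain ⟨δ, hδ0, hδ1, hδ⟩ : ∃ δ : ℝ, 0 < δ ∧ δ ≤ 1 ∧ ∀ k, δ * A ≤ ε k ^ p := by
    have h1 : ∀ k, ∀ᶠ δ : ℝ in nhdsWithin 0 (Set.Ioi 0), δ * A ≤ ε k ^ p := by
      intro k
      have : Filter.Tendsto (fun δ : ℝ ↦ δ * A) (nhdsWithin 0 (Set.Ioi 0)) (nhds (0 * A)) :=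
        ((continuous_id.mul continuous_const).tendsto 0).mono_left nhdsWithin_le_nhds
      rw [zero_mul] at this
      exact this.eventually_le_const (Real.rpow_pos_of_pos (hε k) p)
    obtain ⟨δ, h2, h3, h4⟩ := ((Filter.eventually_all.2 h1).and
      (Ioc_mem_nhdsGT (zero_lt_one' ℝ))).exists
    exact ⟨δ, h3, h4, h2⟩
  refine ⟨δ, hδ0, fun η ↦ mix_dirac_mem_MTH (by linarith) Q ε η ?_ fun k ↦ ?_⟩
  · rw [ENNReal.ofReal_le_one, div_le_one (by positivity)]
    have : 0 ≤ dist ζ η ^ p := by positivity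
    linarith
  · refine (mul_le_mul_right (hcost k η) _).trans ?_
    rw [← ENNReal.ofReal_mul (by positivity)]
    refine ENNReal.ofReal_le_ofReal (le_trans (le_of_eq ?_) (hδ k))
    field_simp

theorem mainTheorem3 {n : ℕ} {X : Fin n → Type*} [∀ k, MetricSpace (X k)]
    [MetricSpace (ProductSpace X)] [CompleteSpace (ProductSpace X)]
    [TopologicalSpace.SeparableSpace (ProductSpace X)]
    [MeasurableSpace (ProductSpace X)] [BorelSpace (ProductSpace X)]
    (hρ : EquivalentToProductMetric X)
    (p : ℝ) (hp : 1 ≤ p)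
    (Q : Measure (ProductSpace X)) [IsProbabilityMeasure Q] (hQ : HasFiniteMoment p Q)
    (ε : Fin n → ℝ) (hε : ∀ k, 0 < ε k)
    (h : ProductSpace X → ℝ) (hmeas : Measurable h) (hint : Integrable h Q) :
    (worstCaseExpectation p Q ε h ≠ ⊥ ∧ worstCaseExpectation p Q ε h ≠ ⊤) ↔
      h ∈ GrowthUp (ProductSpace X) p := by
  have : SecondCountableTopology (ProductSpace X) :=
    UniformSpace.secondCountable_of_separable _
  have hneg : ∫⁻ ξ, ENNReal.ofReal (-h ξ) ∂Q ≠ ∞ := hint.neg.lintegral_lt_top.ne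
  constructor
  · rintro ⟨-, htop⟩
    by_contra hgrow
    obtain ⟨ζ, -⟩ := id hQ
    obtain ⟨δ, hδ0, hδ⟩ := exists_forall_mix_dirac_mem_MTH hρ hp hQ hε ζ
    refine htop (EReal.eq_top_iff_forall_lt _ |>.2 fun y ↦ ?_)
    set B := (∫⁻ ξ, ENNReal.ofReal (-h ξ) ∂Q).toReal with hB
    have hB0 : 0 ≤ B := ENNReal.toReal_nonneg
    -- Chosen so that the share moved to `η` alone contributes at least `|y| + B + 1`, which exceeds
    -- `y` even after losing `B`.
    set N := (|y| + B + 1) / δ with hN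
    have hN0 : 0 < N := by positivity
    obtain ⟨η, hη⟩ : ∃ η, N * (1 + dist ζ η ^ p) < h η := by
      by_contra! hcon
      exact hgrow ⟨N, hN0, ζ, hcon⟩
    have hw : 0 < 1 + dist ζ η ^ p := by positivity
    have hhη : 0 < h η := (by positivity : 0 < N * (1 + dist ζ η ^ p)).trans hη
    set t := δ / (1 + dist ζ η ^ p) with ht
    have hplus : ENNReal.ofReal (|y| + B + 1) ≤ ∫⁻ ξ, ENNReal.ofReal (h ξ)
        ∂((1 - ENNReal.ofReal t) • Q + ENNReal.ofReal t • Measure.dirac η) := by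
      rw [lintegral_add_measure, lintegral_smul_measure, lintegral_smul_measure,
        lintegral_dirac' _ hmeas.ennreal_ofReal, smul_eq_mul, smul_eq_mul,
        ← ENNReal.ofReal_mul (by positivity)]
      refine le_add_of_le_right (ENNReal.ofReal_le_ofReal ?_)
      calc |y| + B + 1 = t * (N * (1 + dist ζ η ^ p)) := by rw [ht, hN]; field_simp
        _ ≤ t * h η := by gcongr
    -- Since `h η > 0`, the Dirac part adds nothing to the negative part.
    have hminus : ∫⁻ ξ, ENNReal.ofReal (-h ξ)
        ∂((1 - ENNReal.ofReal t) • Q + ENNReal.ofReal t • Measure.dirac η) ≤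
          ENNReal.ofReal B := by
      rw [lintegral_add_measure, lintegral_smul_measure, lintegral_smul_measure,
        lintegral_dirac' (f := fun ξ ↦ ENNReal.ofReal (-h ξ)) η hmeas.neg.ennreal_ofReal, ENNReal.ofReal_of_nonpos (neg_nonpos.2 hhη.le),
        smul_zero, add_zero, smul_eq_mul, hB, ENNReal.ofReal_toReal hneg]
      exact mul_le_of_le_one_left' tsub_le_self
    calc (y : EReal) < ((|y| + B + 1 - B : ℝ) : EReal) := by
          rw [EReal.coe_lt_coe_iff]
          linarith [le_abs_self y]
      _ = ((ENNReal.ofReal (|y| + B + 1) : ℝ≥0∞) : EReal) - ((ENNReal.ofReal B : ℝ≥0∞) : EReal) := by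
          rw [EReal.coe_ennreal_ofReal, EReal.coe_ennreal_ofReal, max_eq_left (by positivity),
            max_eq_left hB0, EReal.coe_sub]
      _ ≤ extExpectation ((1 - ENNReal.ofReal t) • Q + ENNReal.ofReal t • Measure.dirac η) h :=
          EReal.sub_le_sub (EReal.coe_ennreal_le_coe_ennreal_iff.2 hplus)
            (EReal.coe_ennreal_le_coe_ennreal_iff.2 hminus)
      _ ≤ worstCaseExpectation p Q ε h := le_iSup₂_of_le _ (hδ η) le_rfl
  · rintro ⟨C, hC, ζ, hζ⟩
    constructor
    · refine ne_of_gt (lt_of_lt_of_le ?_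
        (le_iSup₂_of_le Q (self_mem_MTH (by linarith) Q ε) le_rfl))
      rw [extExpectation, ← EReal.coe_ennreal_toReal hneg,
        ← EReal.coe_ennreal_toReal hint.lintegral_lt_top.ne, ← EReal.coe_sub]
      exact EReal.bot_lt_coe _
    · obtain ⟨M, hM, hPM⟩ := exists_forall_mem_MTH_lintegral_le hρ hp hQ ε ζ
      refine ne_of_lt (lt_of_le_of_lt (iSup₂_le fun P hP ↦ ?_)
        (lt_top_iff_ne_top.2 (EReal.coe_ennreal_eq_top_iff.not.2
          (ENNReal.mul_ne_top (ENNReal.ofReal_ne_top (r := C)) (ENNReal.add_ne_top.2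
            ⟨ENNReal.one_ne_top, hM⟩)))))
      have hP1 : P Set.univ = 1 := by
        obtain ⟨π, hπ, -, rfl, -⟩ := hP
        rw [Measure.map_apply measurable_snd .univ, Set.preimage_univ, measure_univ]
      -- Dropping the negative part is valid even when its integral is infinite.
      refine (EReal.sub_le_sub le_rfl (EReal.coe_ennreal_nonneg _)).trans ?_
      rw [sub_zero, EReal.coe_ennreal_le_coe_ennreal_iff]
      calc ∫⁻ ξ, ENNReal.ofReal (h ξ) ∂P
          ≤ ∫⁻ ξ, ENNReal.ofReal C * (1 + ENNReal.ofReal (dist ζ ξ ^ p)) ∂P := by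
            refine lintegral_mono fun ξ ↦ ?_
            rw [← ENNReal.ofReal_one, ← ENNReal.ofReal_add zero_le_one (by positivity),
              ← ENNReal.ofReal_mul hC.le]
            exact ENNReal.ofReal_le_ofReal (hζ ξ)
        _ = ENNReal.ofReal C * (1 + ∫⁻ ξ, ENNReal.ofReal (dist ζ ξ ^ p) ∂P) := by
            rw [lintegral_const_mul' _ _ ENNReal.ofReal_ne_top,
              lintegral_add_left measurable_const, lintegral_const, hP1, mul_one]
        _ ≤ ENNReal.ofReal C * (1 + M) := by
            gcongr
            exact hPM P hP
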